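/- Conventions. All subcategories are full, and $X\perp Y$ means that every morphism $X\to Y$ is zero (for classes of objects: $X \perp Y$ for all $X$ in the first class and $Y$ in the second). The Karoubi-closure of a subcategory $B\subset A$ in $A$ is the full subcategory of all retracts in $A$ of objects of $B$. An object $X$ of an additive category $A$ is compact if the functor $A(X,-)$ to abelian groups respects all small coproducts that exist in $A$. A class $D$ of objects of a triangulated category is extension-stable if for any distinguished triangle $A\to B\to A'\to A[1]$ with $A,A'\in D$ we have $B\in D$. For a set $H$ of objects, $\langle H\rangle$ is the smallest strictly full triangulated subcategory containing $H$; $H$ is negative if $H\perp H[i]$ for all $i>0$. A weight structure $w$ on a triangulated category $\underline C$ consists of two classes $\underline C^{w\le 0},\underline C^{w\ge 0}$ of objects that are additive and closed under retracts in $\underline C$ and satisfy: $\underline C^{w\ge 0}\subset \underline C^{w\ge 0}[1]$ and $\underline C^{w\le 0}[1]\subset \underline C^{w\le 0}$; $\underline C^{w\ge 0}\perp \underline C^{w\le 0}[1]$; for every object $X$ there is a distinguished triangle $B[-1]\to X\to A\to B$ with $A\in \underline C^{w\le 0}$ and $B\in \underline C^{w\ge 0}$. One puts $\underline C^{w\le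 i}=\underline C^{w\le 0}[-i]$, $\underline C^{w\ge i}=\underline C^{w\ge 0}[-i]$ and $\underline C^{[i,j]}=\underline C^{w\ge i}\cap\underline C^{w\le j}$; the heart $\underline{Hw}$ is the full subcategory on $\underline C^{w\ge 0}\cap\underline C^{w\le 0}$; and $w$ is bounded if $\bigcup_{i\in\mathbb Z}\underline C^{w\le i}=\operatorname{Obj}\underline C=\bigcup_{i\in\mathbb Z}\underline C^{w\ge i}$. **Proposition.** Let $\underline D$ be a triangulated category and let $H$ be an additive, negative set of compact objects of $\underline D$ that weakly generates $\underline D$, i.e. any $X$ with $h[j]\perp X$ for all $h\in H$, $j\in\mathbb Z$ is zero. Suppose that there is an extension-stable class $D\subset\operatorname{Obj}\underline D$ such that $H\cup D[1]\subset D$ and such that all small coproducts of objects of $D$ exist in $\underline D$ and belong to $D$. Let $\underline C\subset\underline D$ be an idempotent complete triangulated subcategory that contains $H$, all of whose objects are compact in $\underline D$, and that is bounded with respect to $H$, i.e. for every $X\in\operatorname{Obj}\underline C$ there exist $j_X,q_X\in\mathbb Z$ with $$H\perp X[i]\ \text{ for all } i>q_X,\qquad X[i]\perp H\ \text{ for all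 } i<j_X. \tag{3}$$ Then: 1. $\underline C$ is contained in the Karoubi-closure of $\langle H\rangle$ in $\underline D$. 2. There exists a bounded weight structure $w$ on $\underline C$ whose heart is the Karoubi-closure of $H$ in $\underline C$. 3. For this $w$, for every $X\in\operatorname{Obj}\underline C$ and all $j,q\in\mathbb Z$: if (3) holds with $j_X=j$ and $q_X=q$, then $X\in\underline C^{[j,q]}$. -/

import Mathlib

open CategoryTheory CategoryTheory.Limits CategoryTheory.Pretriangulated

universe v u

namespace WeightLemma

section Additive

variable {C : Type u} [Category.{v} C] [Preadditive C]

/-- The full subcategory of `C` on the objects satisfying `H` is additive: it contains a zero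
object, and with any two objects it contains (an object isomorphic to) their direct sum. -/
structure IsAdditive (H : ObjectProperty C) : Prop where
  exists_zero : ∃ Z : C, H Z ∧ IsZero Z
  exists_sum : ∀ X Y : C, H X → H Y → ∃ b : BinaryBicone X Y, Nonempty b.IsBilimit ∧ H b.pt

/-- `X ⊥ Y`: every morphism from `X` to `Y` is zero. -/
def Orth (X Y : C) : Prop := ∀ f : X ⟶ Y, f = 0

/-- `X` is compact: the functor `C(X, -)`, with values in abelian groups, respects all the small
coproducts that exist in `C` (no coproducts are assumed to exist). -/
def IsCompactObject (X : C) : Prop :=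
  ∀ J : Type v, PreservesColimitsOfShape (Discrete J) (preadditiveCoyoneda.obj (Opposite.op X))

/-- All small coproducts, in `C`, of objects satisfying `D` exist and satisfy `D`. -/
def HasSmallCoproductsIn (D : ObjectProperty C) : Prop :=
  ∀ (J : Type v) (F : J → C), (∀ j, D (F j)) →
    ∃ c : Cofan F, Nonempty (IsColimit c) ∧ D c.pt

end Additive

section Triangulated

variable {C : Type u} [Category.{v} C] [Preadditive C] [HasZeroObject C] [HasShift C ℤ]
  [∀ n : ℤ, (shiftFunctor C n).Additive]

/-- `H` is negative: `H ⊥ H[i]` for all `i > 0`. -/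
def IsNegative (H : ObjectProperty C) : Prop :=
  ∀ X Y : C, H X → H Y → ∀ i : ℤ, 0 < i → Orth X (Y⟦i⟧)

/-- The objects of `H` weakly generate `C`: an object `X` such that `h[j] ⊥ X` for all `h` in `H`
and all integers `j` is zero. -/
def WeaklyGenerates (H : ObjectProperty C) : Prop :=
  ∀ X : C, (∀ h : C, H h → ∀ j : ℤ, Orth (h⟦j⟧) X) → IsZero X

/-- The orthogonality bounds: `H ⊥ X[i]` for all `i > q`, and `X[i] ⊥ H` for all `i < j`. -/
def OrthBounds (H : ObjectProperty C) (X : C) (j q : ℤ) : Prop :=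
  (∀ h : C, H h → ∀ i : ℤ, q < i → Orth h (X⟦i⟧)) ∧
    (∀ h : C, H h → ∀ i : ℤ, i < j → Orth (X⟦i⟧) h)

/-- `C` is bounded with respect to `H`. -/
def BoundedWithRespectTo (H : ObjectProperty C) : Prop :=
  ∀ X : C, ∃ j q : ℤ, OrthBounds H X j q

variable [Pretriangulated C]

/-- If the outer terms of a distinguished triangle `A ⟶ B ⟶ B' ⟶ A[1]` are in `D`,
so is the middle one. -/
def ExtensionStable (D : ObjectProperty C) : Prop :=
  ∀ T : Triangle C, T ∈ distTriang C → D T.obj₁ → D T.obj₃ → D T.obj₂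

/-- `⟨H⟩`: the smallest strictly full triangulated subcategory of `C` containing `H`. -/
def triangulatedSpan (H : ObjectProperty C) : ObjectProperty C := fun X =>
  ∀ Q : ObjectProperty C, Q.IsTriangulated → Q.IsClosedUnderIsomorphisms → H ≤ Q → Q X

variable (C) in
/-- A weight structure on `C`, in the cohomological convention: complexes concentrated in
non-positive degrees have weights `≤ 0`. -/
structure WeightStructure where
  /-- the class of objects of weights `≤ 0` -/
  leZero : ObjectProperty C
  /-- the class of objects of weights `≥ 0` -/
  geZero : ObjectProperty C
  leZero_additive : IsAdditive leZero
  geZero_additive : IsAdditive geZero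
  leZero_karoubiClosed : leZero.IsStableUnderRetracts
  geZero_karoubiClosed : geZero.IsStableUnderRetracts
  leZero_shift : ∀ X : C, leZero X → leZero (X⟦(1 : ℤ)⟧)
  geZero_shift : ∀ X : C, geZero X → geZero (X⟦(-1 : ℤ)⟧)
  orth : ∀ X Y : C, geZero X → leZero Y → Orth X (Y⟦(1 : ℤ)⟧)
  /-- every `X` has a weight decomposition `B[-1] ⟶ X ⟶ A ⟶ B` -/
  exists_decomposition : ∀ X : C, ∃ (A B : C) (_ : leZero A) (_ : geZero B)
    (f : B⟦(-1 : ℤ)⟧ ⟶ X) (g : X ⟶ A) (h : A ⟶ (B⟦(-1 : ℤ)⟧)⟦(1 : ℤ)⟧),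
    Triangle.mk f g h ∈ distTriang C

namespace WeightStructure

variable (w : WeightStructure C)

/-- The objects of weights `≤ i`, i.e. those of `leZero` shifted by `-i`. -/
def le (i : ℤ) : ObjectProperty C := fun X => w.leZero (X⟦i⟧)

/-- The objects of weights `≥ i`, i.e. those of `geZero` shifted by `-i`. -/
def ge (i : ℤ) : ObjectProperty C := fun X => w.geZero (X⟦i⟧)

/-- The objects whose weights are in `[i, j]`. -/
def interval (i j : ℤ) : ObjectProperty C := fun X => w.ge i X ∧ w.le j X

/-- The objects of the heart. -/
def heart : ObjectProperty C := fun X => w.geZero X ∧ w.leZero X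

/-- Every object has weights `≤ i` and `≥ j` for some integers `i` and `j`. -/
def IsBounded : Prop := ∀ X : C, (∃ i : ℤ, w.le i X) ∧ (∃ j : ℤ, w.ge j X)

end WeightStructure

end Triangulated

end WeightLemma

/-!
The weight structure is defined by orthogonality: `X` has weights `≤ 0` if `h ⊥ X⟦i⟧` for all `h` in
`H` and `i > 0`, and weights `≥ 0` if `X ⊥ h⟦i⟧` for these `h` and `i`. With this definition, the
orthogonality bounds give the weights of an object by a mere shift, and everything else follows once
it is known that the objects of `C` are finite "cell complexes" up to retracts: an object `X` with
`h⟦j⟧ ⊥ X` for `j < a` and `X ⊥ h⟦i⟧` for `i > b` is obtained from a retract of some `h⟦a⟧`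
by successive extensions by objects `h⟦i⟧` with `a < i ≤ b`
(`IsGeneratingContext.peeling_induction` and `IsGeneratingContext.exists_retract_shift`).
This shows that `X` is a retract of an object of `⟨H⟩`, it reduces the orthogonality axiom to the
case of the cells, and by separating the cells of dimension at least `0` from the others, it gives
the weight decompositions. In the case `a = b = 0`, it determines the heart.

To split off the top cell one may assume `a = 0`. Attaching large coproducts of objects `h⟦n⟧`, for
`n = 0, 1, …`, one obtains triangles `X ⟶ Yₙ ⟶ Gₙ ⟶ X⟦1⟧` in which `h⟦j⟧ ⊥ Yₙ` for `j < n`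
(`IsGeneratingContext.exists_next_stage`). All the `Gₙ` are in `D`, so that their homotopy colimit
exists; it is isomorphic to `X⟦1⟧` because `H` consists of compact objects and weakly generates.
As `X` is compact, `X⟦1⟧` is a retract of some `Gₙ`
(`IsGeneratingContext.exists_section_of_telescope`), which means that `X ⟶ Yₙ` is zero for large
`n`. If `X ⊥ h⟦i⟧` for `i > b`, the cells of dimension larger than `b` do not matter, hence
`X ⟶ Y_{b + 1}` is already zero and `X ⟶ Y_b` factors through a coproduct of objects `h⟦b⟧`,
thus, by compactness again, through a single `h⟦b⟧`
(`IsGeneratingContext.exists_stage_factorsThroughShift`). For `b = 0` this makes `X` a retract of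
`h`; for `b > 0`, the fibre of `X ⟶ h⟦b⟧` has one cell less, because any morphism from `X` to an
`h'⟦b⟧` extends to `Y_b`, and therefore factors through `X ⟶ h⟦b⟧`.
-/

namespace WeightLemma

/-! ### Compact objects -/

section Preadditive

variable {C : Type u} [Category.{v} C] [Preadditive C]

lemma IsCompactObject.of_iso {X Y : C} (e : X ≅ Y) (hX : IsCompactObject X) :
    IsCompactObject Y := fun J =>
  have := hX J
  preservesColimitsOfShape_of_natIso (preadditiveCoyoneda.mapIso e.symm.op)

/-- A morphism from a compact object to a coproduct is a finite sum of morphisms which factor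
through the summands, here phrased as an induction principle: the functor `Hom(K, -)` preserves the
coproduct, and the summands of a coproduct of abelian groups generate it. -/
lemma IsCompactObject.induction {K : C} (hK : IsCompactObject K) {J : Type v} {F : J → C}
    {c : Cofan F} (hc : IsColimit c) {p : (K ⟶ c.pt) → Prop} (zero : p 0)
    (add : ∀ f g, p f → p g → p (f + g)) (comp_inj : ∀ (j : J) (g : K ⟶ F j), p (g ≫ c.inj j))
    (f : K ⟶ c.pt) : p f := by
  let S : AddSubgroup (K ⟶ c.pt) :=
    AddSubgroup.closure {f | ∃ (j : J) (g : K ⟶ F j), f = g ≫ c.inj j}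
  have := hK J
  have hc' := isColimitOfPreserves (preadditiveCoyoneda.obj (Opposite.op K)) hc
  let q : (preadditiveCoyoneda.obj (Opposite.op K)).obj c.pt ⟶
      AddCommGrpCat.of ((K ⟶ c.pt) ⧸ S) := AddCommGrpCat.ofHom (QuotientAddGroup.mk' S)
  have hq : q = 0 := by
    refine hc'.hom_ext fun ⟨j⟩ => ?_
    ext g
    exact (QuotientAddGroup.eq_zero_iff _).2 (AddSubgroup.subset_closure ⟨j, g, rfl⟩)
  have hf : f ∈ S := by
    rw [← QuotientAddGroup.eq_zero_iff]
    exact ConcreteCategory.congr_hom hq f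
  have key : p f ∧ p (-f) := by
    induction hf using AddSubgroup.closure_induction with
    | mem f hf =>
      obtain ⟨j, g, rfl⟩ := hf
      rw [← Preadditive.neg_comp]
      exact ⟨comp_inj j g, comp_inj j _⟩
    | zero => rw [neg_zero]; exact ⟨zero, zero⟩
    | add f g _ _ hf hg => rw [neg_add]; exact ⟨add _ _ hf.1 hg.1, add _ _ hf.2 hg.2⟩
    | neg f _ hf => rw [neg_neg]; exact ⟨hf.2, hf.1⟩
  exact key.1

/-! ### Orthogonality -/

lemma Orth.of_iso {X X' Y Y' : C} (e : X ≅ X') (e' : Y ≅ Y') (h : Orth X Y) : Orth X' Y' := by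
  intro f
  have := h (e.hom ≫ f ≫ e'.inv)
  rw [← cancel_epi e.hom, ← cancel_mono e'.inv, Category.assoc, this]
  simp

lemma Orth.of_retract {X X' Y Y' : C} (e : Retract X' X) (e' : Retract Y' Y) (h : Orth X Y) :
    Orth X' Y' := by
  intro f
  have : f = e.i ≫ (e.r ≫ f ≫ e'.i) ≫ e'.r := by simp
  rw [this, h (e.r ≫ f ≫ e'.i)]
  simp

lemma Orth.of_isZero_left {X Y : C} (hX : IsZero X) : Orth X Y := fun _ => hX.eq_of_src _ _

lemma Orth.of_isZero_right {X Y : C} (hY : IsZero Y) : Orth X Y := fun _ => hY.eq_of_tgt _ _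

end Preadditive

section Shift

variable {𝒟 : Type u} [Category.{v} 𝒟] [Preadditive 𝒟] [HasShift 𝒟 ℤ]

/-- There are no nonzero morphisms to `X` from the objects `h⟦j⟧` with `h` in `H` and `j < a`. -/
def OrthBelow (H : ObjectProperty 𝒟) (a : ℤ) : ObjectProperty 𝒟 := fun X =>
  ∀ h, H h → ∀ j : ℤ, j < a → Orth (h⟦j⟧) X

/-- There are no nonzero morphisms from `X` to the objects `h⟦i⟧` with `h` in `H` and `b < i`. -/
def OrthAbove (H : ObjectProperty 𝒟) (b : ℤ) : ObjectProperty 𝒟 := fun X =>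
  ∀ h, H h → ∀ i : ℤ, b < i → Orth X (h⟦i⟧)

instance (H : ObjectProperty 𝒟) (a : ℤ) : (OrthBelow H a).IsClosedUnderIsomorphisms where
  of_iso e hX h hh j hj := (hX h hh j hj).of_iso (Iso.refl _) e

instance (H : ObjectProperty 𝒟) (b : ℤ) : (OrthAbove H b).IsClosedUnderIsomorphisms where
  of_iso e hX h hh i hi := (hX h hh i hi).of_iso e (Iso.refl _)

lemma OrthBelow.mono {H : ObjectProperty 𝒟} {a a' : ℤ} (ha : a' ≤ a) {X : 𝒟}
    (hX : OrthBelow H a X) : OrthBelow H a' X :=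
  fun h hh j hj => hX h hh j (by omega)

lemma OrthAbove.mono {H : ObjectProperty 𝒟} {b b' : ℤ} (hb : b ≤ b') {X : 𝒟}
    (hX : OrthAbove H b X) : OrthAbove H b' X :=
  fun h hh i hi => hX h hh i (by omega)

instance (H : ObjectProperty 𝒟) (a : ℤ) : (OrthBelow H a).IsStableUnderRetracts where
  of_retract r hX h hh j hj := (hX h hh j hj).of_retract (Retract.refl _) r

instance (H : ObjectProperty 𝒟) (b : ℤ) : (OrthAbove H b).IsStableUnderRetracts where
  of_retract r hX h hh i hi := (hX h hh i hi).of_retract r (Retract.refl _)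

lemma OrthAbove.of_mem {H : ObjectProperty 𝒟} (hneg : IsNegative H) {h : 𝒟} (hh : H h) :
    OrthAbove H 0 h := fun h' hh' i hi => hneg h h' hh hh' i hi

variable [∀ n : ℤ, (shiftFunctor 𝒟 n).Additive]

lemma orth_shift_iff {X Y : 𝒟} (n : ℤ) : Orth (X⟦n⟧) (Y⟦n⟧) ↔ Orth X Y := by
  constructor
  · intro h f
    exact (shiftFunctor 𝒟 n).map_injective (by rw [h (f⟦n⟧'), Functor.map_zero])
  · intro h f
    obtain ⟨g, rfl⟩ := (shiftFunctor 𝒟 n).map_surjective f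
    rw [h g, Functor.map_zero]

lemma orth_shift_shift_iff {X Y : 𝒟} {a b a' b' : ℤ} (h : b - a = b' - a') :
    Orth (X⟦a⟧) (Y⟦b⟧) ↔ Orth (X⟦a'⟧) (Y⟦b'⟧) := by
  rw [← orth_shift_iff (a' - a)]
  let e : (X⟦a⟧)⟦a' - a⟧ ≅ X⟦a'⟧ := ((shiftFunctorAdd' 𝒟 a (a' - a) a' (by omega)).app X).symm
  let e' : (Y⟦b⟧)⟦a' - a⟧ ≅ Y⟦b'⟧ := ((shiftFunctorAdd' 𝒟 b (a' - a) b' (by omega)).app Y).symm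
  exact ⟨Orth.of_iso e e', Orth.of_iso e.symm e'.symm⟩

lemma orth_shift_left_iff {X Y : 𝒟} {a b : ℤ} (h : a + b = 0) :
    Orth (X⟦a⟧) Y ↔ Orth X (Y⟦b⟧) := by
  rw [← orth_shift_iff b]
  let e : (X⟦a⟧)⟦b⟧ ≅ X := (shiftFunctorCompIsoId 𝒟 a b h).app X
  exact ⟨Orth.of_iso e (Iso.refl _), Orth.of_iso e.symm (Iso.refl _)⟩

lemma OrthBelow.of_mem {H : ObjectProperty 𝒟} (hneg : IsNegative H) {h : 𝒟} (hh : H h) :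
    OrthBelow H 0 h := fun h' hh' j hj =>
  (orth_shift_left_iff (by omega : j + -j = 0)).2 (hneg h' h hh' hh (-j) (by omega))

lemma OrthBelow.shift {H : ObjectProperty 𝒟} {a : ℤ} {X : 𝒟} (hX : OrthBelow H a X)
    {n a' : ℤ} (ha' : a + n = a') : OrthBelow H a' (X⟦n⟧) := fun h hh j hj =>
  ((orth_shift_iff n).2 (hX h hh (j - n) (by omega))).of_iso
    ((shiftFunctorAdd' 𝒟 (j - n) n j (by omega)).app h).symm (Iso.refl _)

lemma OrthAbove.shift {H : ObjectProperty 𝒟} {b : ℤ} {X : 𝒟} (hX : OrthAbove H b X)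
    {n b' : ℤ} (hb' : b + n = b') : OrthAbove H b' (X⟦n⟧) := fun h hh i hi =>
  ((orth_shift_iff n).2 (hX h hh (i - n) (by omega))).of_iso (Iso.refl _)
    ((shiftFunctorAdd' 𝒟 (i - n) n i (by omega)).app h).symm

end Shift

section FullSubcategory

variable {𝒟 : Type u} [Category.{v} 𝒟] {C : ObjectProperty 𝒟}

lemma orth_ι_iff [Preadditive 𝒟] {X Y : C.FullSubcategory} :
    Orth (C.ι.obj X) (C.ι.obj Y) ↔ Orth X Y := by
  constructor
  · intro h f
    exact C.ι.map_injective ((h (C.ι.map f)).trans (C.ι.map_zero _ _).symm)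
  · intro h f
    obtain ⟨g, rfl⟩ := C.ι.map_surjective f
    rw [h g, Functor.map_zero]

lemma isStableUnderRetracts_inverseImage_ι (P : ObjectProperty 𝒟) [P.IsStableUnderRetracts] :
    (P.inverseImage C.ι).IsStableUnderRetracts where
  of_retract r hX := P.prop_of_retract (r.map C.ι) hX

end FullSubcategory

section Triangulated

open scoped ZeroObject

variable {𝒟 : Type u} [Category.{v} 𝒟] [Preadditive 𝒟] [HasZeroObject 𝒟] [HasShift 𝒟 ℤ]
  [∀ n : ℤ, (shiftFunctor 𝒟 n).Additive] [Pretriangulated 𝒟]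

lemma Orth.obj₂_right {T : Triangle 𝒟} (hT : T ∈ distTriang 𝒟) {K : 𝒟} (h₁ : Orth K T.obj₁)
    (h₃ : Orth K T.obj₃) : Orth K T.obj₂ := by
  intro f
  obtain ⟨g, rfl⟩ := T.coyoneda_exact₂ hT f (h₃ _)
  rw [h₁ g, zero_comp]

lemma Orth.obj₂_left {T : Triangle 𝒟} (hT : T ∈ distTriang 𝒟) {Z : 𝒟} (h₁ : Orth T.obj₁ Z)
    (h₃ : Orth T.obj₃ Z) : Orth T.obj₂ Z := by
  intro f
  obtain ⟨g, rfl⟩ := T.yoneda_exact₂ hT f (h₁ _)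
  rw [h₃ g, comp_zero]

lemma orthBelow_extensionStable (H : ObjectProperty 𝒟) (a : ℤ) :
    ExtensionStable (OrthBelow H a) := fun _ hT h₁ h₃ h hh j hj =>
  Orth.obj₂_right hT (h₁ h hh j hj) (h₃ h hh j hj)

lemma orthAbove_extensionStable (H : ObjectProperty 𝒟) (b : ℤ) :
    ExtensionStable (OrthAbove H b) := fun _ hT h₁ h₃ h hh i hi =>
  Orth.obj₂_left hT (h₁ h hh i hi) (h₃ h hh i hi)

instance (H : ObjectProperty 𝒟) : (triangulatedSpan H).IsClosedUnderIsomorphisms where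
  of_iso e hX Q hQ hQ' hHQ := Q.prop_of_iso e (hX Q hQ hQ' hHQ)

instance (H : ObjectProperty 𝒟) : (triangulatedSpan H).IsTriangulated where
  exists_zero := ⟨0, isZero_zero 𝒟, fun Q _ _ _ => Q.prop_zero⟩
  isStableUnderShiftBy n := ⟨fun X hX Q hQ hQ' hHQ => Q.le_shift n X (hX Q hQ hQ' hHQ)⟩
  toIsTriangulatedClosed₂ := .mk' fun T hT h₁ h₃ Q hQ hQ' hHQ =>
    Q.ext_of_isTriangulatedClosed₂ T hT (h₁ Q hQ hQ' hHQ) (h₃ Q hQ hQ' hHQ)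

lemma le_triangulatedSpan (H : ObjectProperty 𝒟) : H ≤ triangulatedSpan H :=
  fun X hX _ _ _ hHQ => hHQ X hX

/-! ### Coproducts of shifts of generators -/

/-- The situation of the theorem, with `C` replaced by its closure under isomorphisms: `H` is an
essentially small, additive, negative and weakly generating class of objects, `D` is an aisle-like
class with small coproducts containing `H`, and `C` is a strictly full triangulated subcategory
containing `H` and consisting of compact objects. -/
structure IsGeneratingContext (H D C : ObjectProperty 𝒟) : Prop where
  essentiallySmall : ObjectProperty.EssentiallySmall.{v} H
  additive : IsAdditive H
  negative : IsNegative H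
  generates : WeaklyGenerates H
  extensionStable : ExtensionStable D
  le_D : H ≤ D
  shift_D : ∀ X : 𝒟, D X → D (X⟦(1 : ℤ)⟧)
  coproducts : HasSmallCoproductsIn D
  triangulated : C.IsTriangulated
  isoClosed : C.IsClosedUnderIsomorphisms
  compact : ∀ X : 𝒟, C X → IsCompactObject X
  le_C : H ≤ C

/-- The morphism `f` factors through the shift `h⟦n⟧` of an object `h` of `H`. -/
def FactorsThroughShift (H : ObjectProperty 𝒟) (n : ℤ) {X Y : 𝒟} (f : X ⟶ Y) : Prop :=
  ∃ (h : 𝒟) (_ : H h) (a : X ⟶ h⟦n⟧) (b : h⟦n⟧ ⟶ Y), a ≫ b = f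

namespace IsGeneratingContext

variable {H D C : ObjectProperty 𝒟} (ctx : IsGeneratingContext H D C)
include ctx

lemma orth_of_lt {h h' : 𝒟} (hh : H h) (hh' : H h') {a b : ℤ} (hab : a < b) :
    Orth (h⟦a⟧) (h'⟦b⟧) :=
  (orth_shift_shift_iff (a := 0) (b := b - a) (by omega)).1
    ((ctx.negative h h' hh hh' (b - a) (by omega)).of_iso
      ((shiftFunctorZero 𝒟 ℤ).app h).symm (Iso.refl _))

lemma C_shift {X : 𝒟} (hX : C X) (n : ℤ) : C (X⟦n⟧) :=
  have := ctx.triangulated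
  C.le_shift n X hX

lemma C_shift_of_mem {h : 𝒟} (hh : H h) (n : ℤ) : C (h⟦n⟧) := ctx.C_shift (ctx.le_C h hh) n

lemma exists_isZero_D : ∃ Z : 𝒟, IsZero Z ∧ D Z := by
  obtain ⟨c, ⟨hc⟩, hD⟩ := ctx.coproducts PEmpty PEmpty.elim (fun j => j.elim)
  exact ⟨c.pt, (IsZero.iff_id_eq_zero _).2 (hc.hom_ext fun ⟨j⟩ => j.elim), hD⟩

lemma D_of_iso {X Y : 𝒟} (e : X ≅ Y) (hX : D X) : D Y := by
  obtain ⟨Z, hZ, hDZ⟩ := ctx.exists_isZero_D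
  exact ctx.extensionStable (Triangle.mk e.hom (0 : Y ⟶ Z) 0)
    ((Triangle.distinguished_iff_of_isZero₃ _ hZ).2 (inferInstanceAs (IsIso e.hom))) hX hDZ

lemma D_shift_of_mem {h : 𝒟} (hh : H h) (n : ℕ) : D (h⟦(n : ℤ)⟧) := by
  induction n with
  | zero => exact ctx.D_of_iso ((shiftFunctorZero 𝒟 ℤ).app h).symm (ctx.le_D h hh)
  | succ n ih =>
    exact ctx.D_of_iso ((shiftFunctorAdd' 𝒟 (n : ℤ) 1 _ (by simp)).app h).symm
      (ctx.shift_D _ ih)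

lemma factorsThroughShift_zero (n : ℤ) (X Y : 𝒟) :
    FactorsThroughShift H n (0 : X ⟶ Y) := by
  obtain ⟨Z, hZ, -⟩ := ctx.additive.exists_zero
  exact ⟨Z, hZ, 0, 0, zero_comp⟩

lemma factorsThroughShift_add {n : ℤ} {X Y : 𝒟} {f g : X ⟶ Y}
    (hf : FactorsThroughShift H n f) (hg : FactorsThroughShift H n g) :
    FactorsThroughShift H n (f + g) := by
  obtain ⟨h, hh, a, b, rfl⟩ := hf
  obtain ⟨h', hh', a', b', rfl⟩ := hg
  obtain ⟨β, -, hβ⟩ := ctx.additive.exists_sum h h' hh hh'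
  refine ⟨β.pt, hβ, a ≫ β.inl⟦n⟧' + a' ≫ β.inr⟦n⟧', β.fst⟦n⟧' ≫ b + β.snd⟦n⟧' ≫ b', ?_⟩
  have h₁ : β.inl⟦n⟧' ≫ β.fst⟦n⟧' = 𝟙 _ := by
    rw [← Functor.map_comp, β.inl_fst, CategoryTheory.Functor.map_id]
  have h₂ : β.inr⟦n⟧' ≫ β.snd⟦n⟧' = 𝟙 _ := by
    rw [← Functor.map_comp, β.inr_snd, CategoryTheory.Functor.map_id]
  have h₃ : β.inl⟦n⟧' ≫ β.snd⟦n⟧' = 0 := by rw [← Functor.map_comp, β.inl_snd, Functor.map_zero]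
  have h₄ : β.inr⟦n⟧' ≫ β.fst⟦n⟧' = 0 := by rw [← Functor.map_comp, β.inr_fst, Functor.map_zero]
  simp [reassoc_of% h₁, reassoc_of% h₂, reassoc_of% h₃, reassoc_of% h₄]

/-- Every object `Y` receives a morphism from a coproduct `P` of objects `h⟦n⟧`, `h ∈ H`, through
which all morphisms from such objects factor. Of the structure of `P` as a coproduct, two
consequences are retained: morphisms from objects of `C` to `P` factor through a single `h⟦n⟧`
(by compactness and additivity of `H`), and `P ⊥ Z` as soon as all the `h⟦n⟧ ⊥ Z`. -/
lemma exists_precover (n : ℕ) (Y : 𝒟) : ∃ (P : 𝒟) (π : P ⟶ Y), D P ∧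
    (∀ K, C K → ∀ f : K ⟶ P, FactorsThroughShift H n f) ∧
    (∀ Z : 𝒟, (∀ h, H h → Orth (h⟦(n : ℤ)⟧) Z) → Orth P Z) ∧
    (∀ h, H h → ∀ f : h⟦(n : ℤ)⟧ ⟶ Y, ∃ g, f = g ≫ π) := by
  have := ctx.essentiallySmall
  obtain ⟨Q, _, hQH, hHQ⟩ := ObjectProperty.EssentiallySmall.exists_small_le.{v} H
  let e := equivShrink (Subtype Q)
  let J : Type v := Σ s : Shrink.{v} (Subtype Q), ((e.symm s).1⟦(n : ℤ)⟧ ⟶ Y)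
  have hJ (j : J) : H (e.symm j.1).1 := hQH _ (e.symm j.1).2
  obtain ⟨c, ⟨hc⟩, hD⟩ := ctx.coproducts J (fun j => (e.symm j.1).1⟦(n : ℤ)⟧)
    (fun j => ctx.D_shift_of_mem (hJ j) n)
  refine ⟨c.pt, Cofan.IsColimit.desc hc (fun j => j.2), hD, ?_, ?_, ?_⟩
  · intro K hK f
    induction f using (ctx.compact K hK).induction hc with
    | zero => exact ctx.factorsThroughShift_zero _ _ _
    | add f g hf hg => exact ctx.factorsThroughShift_add hf hg
    | comp_inj j g => exact ⟨_, hJ j, g, c.inj j, rfl⟩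
  · intro Z hZ f
    exact Cofan.IsColimit.hom_ext hc _ _ fun j => (hZ _ (hJ j) _).trans comp_zero.symm
  · intro h hh f
    obtain ⟨h', hh', ⟨i⟩⟩ := hHQ h hh
    -- `h` is replaced by its isomorphic representative in the small class `Q`
    obtain ⟨s, hs⟩ : ∃ s, e.symm s = ⟨h', hh'⟩ := e.symm.surjective _
    have key : ∀ (A : Subtype Q) (hA : e.symm s = A) (i : h ≅ A.1),
        ∃ g, f = g ≫ Cofan.IsColimit.desc hc (fun j => j.2) := by
      rintro _ rfl i
      refine ⟨i.hom⟦(n : ℤ)⟧' ≫ c.inj ⟨s, i.inv⟦(n : ℤ)⟧' ≫ f⟩, ?_⟩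
      rw [Category.assoc, Cofan.IsColimit.fac, ← Functor.map_comp_assoc]
      simp
    exact key _ hs i

/-! ### Homotopy colimits -/

/-- A homotopy colimit argument. Suppose that `p n : G n ⟶ Z` is a cocone with compact target over
a sequence in `D` which exhibits the groups `Hom(h⟦j⟧, Z)` as the colimits of the groups
`Hom(h⟦j⟧, G n)`. The homotopy colimit of `G` exists as `G` is in `D`, it maps to `Z` by an
isomorphism as `H` weakly generates, and the inverse isomorphism factors through some `G N` as
`Z` is compact.

Injectivity on the colimits is phrased without transition morphisms: a morphism `h⟦j⟧ ⟶ G n` which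
vanishes in `Z` vanishes in every cocone over `G`. -/
lemma exists_section_of_telescope (G : ℕ → 𝒟) (t : ∀ n, G n ⟶ G (n + 1)) (hG : ∀ n, D (G n))
    {Z : 𝒟} (hZ : C Z) (p : ∀ n, G n ⟶ Z) (hp : ∀ n, t n ≫ p (n + 1) = p n)
    (hsurj : ∀ h, H h → ∀ j : ℤ, ∃ N, ∀ f : h⟦j⟧ ⟶ Z, ∃ g, f = g ≫ p N)
    (hinj : ∀ h, H h → ∀ (j : ℤ) (n : ℕ) (g : h⟦j⟧ ⟶ G n), g ≫ p n = 0 →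
      ∀ (W : 𝒟) (q : ∀ n, G n ⟶ W), (∀ n, t n ≫ q (n + 1) = q n) → g ≫ q n = 0) :
    ∃ (N : ℕ) (s : Z ⟶ G N), s ≫ p N = 𝟙 Z := by
  obtain ⟨c, ⟨hc⟩, -⟩ := ctx.coproducts (ULift.{v} ℕ) (fun n => G n.down) (fun n => hG n.down)
  let ι (n : ℕ) : G n ⟶ c.pt := c.inj ⟨n⟩
  have hdesc {W : 𝒟} (f : ∀ n, G n ⟶ W) : ∃ φ : c.pt ⟶ W, ∀ n, ι n ≫ φ = f n :=
    ⟨Cofan.IsColimit.desc hc (fun n => f n.down), fun n => Cofan.IsColimit.fac hc _ ⟨n⟩⟩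
  have hext {W : 𝒟} {φ ψ : c.pt ⟶ W} (h : ∀ n, ι n ≫ φ = ι n ≫ ψ) : φ = ψ :=
    Cofan.IsColimit.hom_ext hc _ _ fun n => h n.down
  obtain ⟨σ, hσ⟩ := hdesc (fun n => t n ≫ ι (n + 1))
  obtain ⟨T, u, w, hT⟩ := distinguished_cocone_triangle (𝟙 c.pt - σ)
  have hu : σ ≫ u = u := by
    have := comp_distTriang_mor_zero₁₂ _ hT
    change (𝟙 c.pt - σ) ≫ u = 0 at this
    rw [Preadditive.sub_comp, Category.id_comp, sub_eq_zero] at this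
    exact this.symm
  -- `T` is the homotopy colimit, with the cocone `q`
  let q (n : ℕ) : G n ⟶ T := ι n ≫ u
  have hq (n : ℕ) : t n ≫ q (n + 1) = q n := by
    change t n ≫ ι (n + 1) ≫ u = ι n ≫ u
    conv_rhs => rw [← hu]
    rw [← Category.assoc, ← hσ, Category.assoc]
  -- `𝟙 - σ` is injective on morphisms from compact objects: such a morphism has bounded support
  -- in the coproduct, while `σ` moves the support up.
  have hmono {K : 𝒟} (hK : C K) (g : K ⟶ c.pt) (hg : g ≫ (𝟙 c.pt - σ) = 0) : g = 0 := by
    have hgσ : g ≫ σ = g := by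
      rw [Preadditive.comp_sub, Category.comp_id, sub_eq_zero] at hg
      exact hg.symm
    have hsupp : ∃ N, ∀ n, N ≤ n → ∀ (W : 𝒟) (φ : c.pt ⟶ W), (∀ k, k < n → ι k ≫ φ = 0) →
        g ≫ φ = 0 := by
      clear hg hgσ
      induction g using (ctx.compact K hK).induction hc with
      | zero => exact ⟨0, fun _ _ _ _ _ => zero_comp⟩
      | add f g hf hg =>
        obtain ⟨N, hN⟩ := hf
        obtain ⟨M, hM⟩ := hg
        refine ⟨max N M, fun n hn W φ hφ => ?_⟩
        rw [Preadditive.add_comp, hN n (le_of_max_le_left hn) W φ hφ,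
          hM n (le_of_max_le_right hn) W φ hφ, add_zero]
      | comp_inj j g =>
        refine ⟨j.down + 1, fun n hn W φ hφ => ?_⟩
        have := hφ j.down (by omega)
        rw [Category.assoc]
        change g ≫ ι j.down ≫ φ = 0
        rw [this, comp_zero]
    obtain ⟨N, hN⟩ := hsupp
    -- `τ` is the projection to the first `N` summands
    obtain ⟨τ, hτ⟩ := hdesc (fun n => if n < N then ι n else 0)
    have hgτ : g ≫ τ = g := by
      have := hN N le_rfl _ (τ - 𝟙 _) (fun k hk => by simp [Preadditive.comp_sub, hτ, hk])
      rwa [Preadditive.comp_sub, Category.comp_id, sub_eq_zero] at this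
    have key : ∀ k, ∃ ψ : c.pt ⟶ c.pt, g = g ≫ ψ ∧ ∀ n, N ≤ n + k → ι n ≫ ψ = 0 := by
      intro k
      induction k with
      | zero => exact ⟨τ, hgτ.symm, fun n hn => by rw [hτ, if_neg (by omega)]⟩
      | succ k ih =>
        obtain ⟨ψ, hψ, hψ'⟩ := ih
        refine ⟨σ ≫ ψ, ?_, fun n hn => ?_⟩
        · rw [← Category.assoc, hgσ, ← hψ]
        · rw [← Category.assoc, hσ, Category.assoc, hψ' (n + 1) (by omega), comp_zero]
    obtain ⟨ψ, hψ, hψ'⟩ := key N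
    have : ψ = 0 := hext fun n => by rw [hψ' n (by omega), comp_zero]
    rw [hψ, this, comp_zero]
  -- By the injectivity above, morphisms from compact objects to `T` lift to the coproduct, and
  -- a finite sum of morphisms to the `G n` can be gathered in a single `G N`.
  have hfactor {K : 𝒟} (hK : C K) (f : K ⟶ T) : ∃ (N : ℕ) (g : K ⟶ G N), f = g ≫ q N := by
    have hfw : f ≫ w = 0 := by
      let e : (K⟦(-1 : ℤ)⟧)⟦(1 : ℤ)⟧ ≅ K := (shiftFunctorCompIsoId 𝒟 (-1 : ℤ) 1 (by simp)).app K
      obtain ⟨g, hg⟩ := (shiftFunctor 𝒟 (1 : ℤ)).map_surjective (e.hom ≫ f ≫ w)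
      have hw : w ≫ (𝟙 c.pt - σ)⟦(1 : ℤ)⟧' = 0 := comp_distTriang_mor_zero₃₁ _ hT
      have : g = 0 := hmono (ctx.C_shift hK (-1)) g
        ((shiftFunctor 𝒟 (1 : ℤ)).map_injective (by
          rw [Functor.map_comp, hg, Category.assoc, Category.assoc, hw]; simp))
      rw [← cancel_epi e.hom, ← hg, this, Functor.map_zero, comp_zero]
    obtain ⟨g, hg⟩ := Triangle.coyoneda_exact₃ _ hT f hfw
    change K ⟶ c.pt at g
    change f = g ≫ u at hg
    have : ∃ N, ∀ n, N ≤ n → ∃ g' : K ⟶ G n, g ≫ u = g' ≫ q n := by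
      clear hg
      induction g using (ctx.compact K hK).induction hc with
      | zero => exact ⟨0, fun n _ => ⟨0, by simp⟩⟩
      | add f g hf hg =>
        obtain ⟨N, hN⟩ := hf
        obtain ⟨M, hM⟩ := hg
        refine ⟨max N M, fun n hn => ?_⟩
        obtain ⟨f', hf'⟩ := hN n (le_of_max_le_left hn)
        obtain ⟨g', hg'⟩ := hM n (le_of_max_le_right hn)
        exact ⟨f' + g', by rw [Preadditive.add_comp, Preadditive.add_comp, hf', hg']⟩
      | comp_inj j g =>
        refine ⟨j.down, fun n hn => ?_⟩
        induction n, hn using Nat.le_induction with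
        | base => exact ⟨g, by rw [Category.assoc]⟩
        | succ n _ ih =>
          obtain ⟨g', hg'⟩ := ih
          exact ⟨g' ≫ t n, by rw [hg', Category.assoc, hq]⟩
    obtain ⟨N, hN⟩ := this
    obtain ⟨g', hg'⟩ := hN N le_rfl
    exact ⟨N, g', hg.trans hg'⟩
  obtain ⟨φ, hφ⟩ := hdesc p
  obtain ⟨π, hπ⟩ : ∃ π : T ⟶ Z, φ = u ≫ π := Triangle.yoneda_exact₂ _ hT φ (hext fun n => by
    change ι n ≫ (𝟙 c.pt - σ) ≫ φ = ι n ≫ 0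
    rw [Preadditive.sub_comp, Preadditive.comp_sub, ← Category.assoc (ι n) σ φ, hσ,
      Category.id_comp, Category.assoc, hφ, hφ, hp, sub_self, comp_zero])
  have hqπ (n : ℕ) : q n ≫ π = p n := by
    change (ι n ≫ u) ≫ π = p n
    rw [Category.assoc, ← hπ, hφ]
  have hinjπ {h : 𝒟} (hh : H h) {j : ℤ} (f : h⟦j⟧ ⟶ T) (hf : f ≫ π = 0) : f = 0 := by
    obtain ⟨N, g, rfl⟩ := hfactor (ctx.C_shift_of_mem hh j) f
    rw [Category.assoc, hqπ] at hf
    exact hinj h hh j N g hf T q hq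
  have hπiso : IsIso π := by
    obtain ⟨Y, a, b, hY⟩ := distinguished_cocone_triangle π
    refine (Triangle.isZero₃_iff_isIso₁ _ hY).1 (ctx.generates Y fun h hh j f => ?_)
    have hfb : f ≫ b = 0 := by
      let e : (h⟦j - 1⟧)⟦(1 : ℤ)⟧ ≅ h⟦j⟧ :=
        ((shiftFunctorAdd' 𝒟 (j - 1) 1 j (by omega)).app h).symm
      obtain ⟨g, hg⟩ := (shiftFunctor 𝒟 (1 : ℤ)).map_surjective (e.hom ≫ f ≫ b)
      have hb : b ≫ π⟦(1 : ℤ)⟧' = 0 := comp_distTriang_mor_zero₃₁ _ hY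
      have : g = 0 := hinjπ hh g ((shiftFunctor 𝒟 (1 : ℤ)).map_injective (by
        rw [Functor.map_comp, hg, Category.assoc, Category.assoc, hb]; simp))
      rw [← cancel_epi e.hom, ← hg, this, Functor.map_zero, comp_zero]
    obtain ⟨g, hg⟩ := Triangle.coyoneda_exact₃ _ hY f hfb
    change h⟦j⟧ ⟶ Z at g
    change f = g ≫ a at hg
    obtain ⟨N, hN⟩ := hsurj h hh j
    obtain ⟨g', rfl⟩ := hN g
    have hπa : π ≫ a = 0 := comp_distTriang_mor_zero₁₂ _ hY
    rw [hg, ← hqπ, Category.assoc, Category.assoc, hπa, comp_zero, comp_zero]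
  obtain ⟨N, s, hs⟩ := hfactor hZ (inv π)
  exact ⟨N, s, by rw [← hqπ, ← Category.assoc, ← hs, IsIso.inv_hom_id]⟩

end IsGeneratingContext

/-! ### Cellular approximation -/

/-- The `n`-th stage of a cellular approximation of `X`: a distinguished triangle
`X ⟶ Y ⟶ G ⟶ X⟦1⟧` in which `Y` receives no morphisms from the `h⟦j⟧` with `j < n`, and `G`
behaves like an extension of coproducts of objects `h⟦i⟧`, `1 ≤ i ≤ n`. -/
structure CellularStage (H D : ObjectProperty 𝒟) (X : 𝒟) (n : ℕ) where
  /-- what remains of `X` once the cells of dimension less than `n` are removed -/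
  Y : 𝒟
  /-- the suspension of the part of `X` built from cells of dimension less than `n` -/
  G : 𝒟
  /-- the first morphism of the triangle -/
  a : X ⟶ Y
  /-- the second morphism of the triangle -/
  b : Y ⟶ G
  /-- the third morphism of the triangle -/
  c : G ⟶ X⟦(1 : ℤ)⟧
  distinguished : Triangle.mk a b c ∈ distTriang 𝒟
  D_G : D G
  orthBelow : OrthBelow H n Y
  orthAbove : OrthAbove H n G

namespace IsGeneratingContext

variable {H D C : ObjectProperty 𝒟} (ctx : IsGeneratingContext H D C)
include ctx

lemma exists_stage_zero {X : 𝒟} (hX : OrthBelow H 0 X) :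
    ∃ S : CellularStage H D X 0, IsIso S.a := by
  obtain ⟨Z, hZ, hDZ⟩ := ctx.exists_isZero_D
  exact ⟨{  Y := X
            G := Z
            a := 𝟙 X
            b := 0
            c := 0
            distinguished := (Triangle.distinguished_iff_of_isZero₃ _ hZ).2
              (inferInstanceAs (IsIso (𝟙 X)))
            D_G := hDZ
            orthBelow := hX
            orthAbove := fun _ _ _ _ => Orth.of_isZero_left hZ }, inferInstanceAs (IsIso (𝟙 X))⟩

/-- The next stage is obtained by removing the cells of dimension `n`: `S'.Y` is the cone of a
precover of `S.Y` by a coproduct `P` of objects `h⟦n⟧`, and by the octahedral axiom `S'.G` is an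
extension of `P⟦1⟧` by `S.G`. -/
lemma exists_next_stage [IsTriangulated 𝒟] {X : 𝒟} {n : ℕ} (S : CellularStage H D X n) :
    ∃ (S' : CellularStage H D X (n + 1)) (x : S.Y ⟶ S'.Y) (t : S.G ⟶ S'.G),
      S.a ≫ x = S'.a ∧ S.b ≫ t = x ≫ S'.b ∧ t ≫ S'.c = S.c ∧
      ∀ K, C K → ∀ f : K ⟶ S.Y, f ≫ x = 0 → FactorsThroughShift H n f := by
  obtain ⟨P, π, hDP, hPfac, hPorth, hπ⟩ := ctx.exists_precover n S.Y
  obtain ⟨Y', x, δ, hY'⟩ := distinguished_cocone_triangle π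
  obtain ⟨G', b', c', hG'⟩ := distinguished_cocone_triangle (S.a ≫ x)
  let O := Triangulated.someOctahedron rfl S.distinguished (rot_of_distTriang _ hY') hG'
  have hπx : π ≫ x = 0 := comp_distTriang_mor_zero₁₂ _ hY'
  let S' : CellularStage H D X (n + 1) :=
    { Y := Y'
      G := G'
      a := S.a ≫ x
      b := b'
      c := c'
      distinguished := hG'
      D_G := ctx.extensionStable _ O.mem S.D_G (ctx.shift_D _ hDP)
      orthBelow := by
        intro h hh j hj f
        have hδ : Orth (h⟦j⟧) (P⟦(1 : ℤ)⟧) := by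
          have : Orth (h⟦j - 1⟧) P := by
            intro f
            obtain ⟨h', hh', u, v, rfl⟩ := hPfac _ (ctx.C_shift_of_mem hh _) f
            rw [ctx.orth_of_lt hh hh' (by push_cast at hj; omega) u, zero_comp]
          exact ((orth_shift_iff 1).2 this).of_iso
            ((shiftFunctorAdd' 𝒟 (j - 1) 1 j (by omega)).app h).symm (Iso.refl _)
        obtain ⟨g, hg⟩ := Triangle.coyoneda_exact₃ _ hY' f (hδ _)
        change h⟦j⟧ ⟶ S.Y at g
        change f = g ≫ x at hg
        rw [hg]
        obtain hj' | rfl : j < n ∨ j = n := by push_cast at hj; omega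
        · rw [S.orthBelow h hh j hj' g, zero_comp]
        · obtain ⟨g', rfl⟩ := hπ h hh g
          rw [Category.assoc, hπx, comp_zero]
      orthAbove := by
        intro h hh i hi
        push_cast at hi
        refine Orth.obj₂_left O.mem (S.orthAbove h hh i (by omega)) ?_
        have : Orth P (h⟦i - 1⟧) := hPorth _ fun h' hh' => ctx.orth_of_lt hh' hh (by omega)
        exact ((orth_shift_iff 1).2 this).of_iso (Iso.refl _)
          ((shiftFunctorAdd' 𝒟 (i - 1) 1 i (by omega)).app h).symm }
  refine ⟨S', x, O.m₁, rfl, O.comm₁, O.comm₂, fun K hK f hf => ?_⟩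
  obtain ⟨g, hg⟩ := Triangle.coyoneda_exact₂ _ hY' f hf
  obtain ⟨h, hh, u, v, rfl⟩ := hPfac K hK g
  exact ⟨h, hh, u, v ≫ π, (Category.assoc _ _ _).symm.trans hg.symm⟩

/-- The main step. If `X ∈ C` admits no morphisms from the `h⟦j⟧` with `j < 0`, nor to the `h⟦i⟧`
with `m < i`, then the morphism from `X` to the `m`-th stage of its cellular approximation factors
through some `h⟦m⟧`: by compactness of `X` it vanishes at a later stage, and the cells of dimension
larger than `m` do not matter. -/
lemma exists_stage_factorsThroughShift [IsTriangulated 𝒟] {X : 𝒟} (hX : C X) (m : ℕ)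
    (hX₀ : OrthBelow H 0 X) (hXm : OrthAbove H m X) :
    ∃ S : CellularStage H D X m, FactorsThroughShift H m S.a ∧ (m = 0 → IsIso S.a) := by
  choose S' x t hax hbt htc hfac using
    fun (n : ℕ) (S : CellularStage H D X n) => ctx.exists_next_stage S
  obtain ⟨S₀, hS₀⟩ := ctx.exists_stage_zero hX₀
  let S : ∀ n, CellularStage H D X n := fun n => Nat.rec S₀ S' n
  have hkill : ∃ N, (S N).a = 0 := by
    have htel : ∃ (N : ℕ) (s : X⟦(1 : ℤ)⟧ ⟶ (S N).G), s ≫ (S N).c = 𝟙 _ := by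
      refine ctx.exists_section_of_telescope (fun n => (S n).G)
        (fun n => t n (S n)) (fun n => (S n).D_G) (ctx.C_shift hX 1) (fun n => (S n).c)
        (fun n => htc n (S n)) ?_ ?_
      · intro h hh j
        refine ⟨j.toNat, fun f => ?_⟩
        have horth : Orth (h⟦j⟧) ((S j.toNat).Y⟦(1 : ℤ)⟧) :=
          ((orth_shift_iff 1).2 ((S j.toNat).orthBelow h hh (j - 1) (by omega))).of_iso
            ((shiftFunctorAdd' 𝒟 (j - 1) 1 j (by omega)).app h).symm (Iso.refl _)
        exact Triangle.coyoneda_exact₁ _ (S j.toNat).distinguished f (horth _)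
      · intro h hh j n g hg W q hq
        obtain ⟨g', hg'⟩ := Triangle.coyoneda_exact₃ _ (S n).distinguished g hg
        change h⟦j⟧ ⟶ (S n).Y at g'
        change g = g' ≫ (S n).b at hg'
        rw [hg', Category.assoc]
        clear hg hg'
        obtain ⟨k, hk⟩ : ∃ k : ℕ, j < n + k := ⟨j.toNat + 1, by omega⟩
        induction k generalizing n with
        | zero => rw [(S n).orthBelow h hh j (by simpa using hk) g', zero_comp]
        | succ k ih =>
          have := ih (n + 1) 0 (g' ≫ x n (S n)) (by push_cast at hk ⊢; omega)
          rw [← hq n, reassoc_of% hbt n (S n), ← Category.assoc]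
          exact this
    obtain ⟨N, s, hs⟩ := htel
    refine ⟨N, (shiftFunctor 𝒟 (1 : ℤ)).map_injective ?_⟩
    have : (S N).c ≫ (S N).a⟦(1 : ℤ)⟧' = 0 := comp_distTriang_mor_zero₃₁ _ (S N).distinguished
    rw [Functor.map_zero, ← Category.id_comp ((shiftFunctor 𝒟 (1 : ℤ)).map (S N).a), ← hs,
      Category.assoc, this, comp_zero]
  -- `X ⟶ Yₙ` may be tested for vanishing at any stage `n > m`
  have hup (n : ℕ) (h : (S n).a = 0) : (S (n + 1)).a = 0 := by
    change (S' n (S n)).a = 0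
    rw [← hax, h, zero_comp]
  have hdown (n : ℕ) (hn : m < n) (h : (S (n + 1)).a = 0) : (S n).a = 0 := by
    obtain ⟨h', hh', u, v, huv⟩ := hfac n (S n) X hX (S n).a ((hax n (S n)).trans h)
    rw [← huv, hXm h' hh' n (by exact_mod_cast hn) u, zero_comp]
  have hm : (S (m + 1)).a = 0 := by
    obtain ⟨N, hN⟩ := hkill
    obtain ⟨k, hk⟩ : ∃ k, N ≤ m + 1 + k := ⟨N, by omega⟩
    have hk' : (S (m + 1 + k)).a = 0 := Nat.le_induction hN (fun n _ => hup n) _ hk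
    clear hk
    induction k with
    | zero => exact hk'
    | succ k ih => exact ih (hdown _ (by omega) hk')
  refine ⟨S m, hfac m (S m) X hX _ ((hax m (S m)).trans hm), ?_⟩
  rintro rfl
  exact hS₀

/-! ### Splitting off cells -/

lemma map_shift_le_inf_orthBelow {a i : ℤ} (hi : a ≤ i) :
    H.map (shiftFunctor 𝒟 i) ≤ C ⊓ OrthBelow H a := by
  have := ctx.isoClosed
  rintro X ⟨h, hh, ⟨e⟩⟩
  refine ⟨C.prop_of_iso e (ctx.C_shift_of_mem hh i), ?_⟩
  exact (OrthBelow H a).prop_of_iso e fun h' hh' j hj => ctx.orth_of_lt hh' hh (by omega)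

variable [IsTriangulated 𝒟]

lemma exists_retract_of_normalized {X : 𝒟} (hX : C X) (hX₀ : OrthBelow H 0 X)
    (hX₀' : OrthAbove H 0 X) : H.retractClosure X := by
  obtain ⟨S, ⟨h, hh, u, v, huv⟩, hS⟩ :=
    ctx.exists_stage_factorsThroughShift hX 0 hX₀ (by simpa using hX₀')
  have := hS rfl
  let r : Retract X (h⟦((0 : ℕ) : ℤ)⟧) := ⟨u, v ≫ inv S.a, by rw [reassoc_of% huv]; simp⟩
  exact ⟨h, hh, ⟨r.trans (Retract.ofIso ((shiftFunctorZero 𝒟 ℤ).app h))⟩⟩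

/-- For `X` as in `exists_stage_factorsThroughShift`, in dimension `m + 1`, the fibre of the
morphism `X ⟶ h⟦m + 1⟧` found there has no cell of dimension `m + 1`. -/
lemma exists_peeling_of_normalized {X : 𝒟} (hX : C X) (m : ℕ) (hX₀ : OrthBelow H 0 X)
    (hXm : OrthAbove H (m + 1) X) :
    (C ⊓ OrthBelow H 0 ⊓ OrthAbove H m).extensionProduct
      (H.map (shiftFunctor 𝒟 (m + 1 : ℤ))) X := by
  have := ctx.isoClosed
  have := ctx.triangulated
  obtain ⟨S, ⟨h, hh, u, v, huv⟩, -⟩ :=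
    ctx.exists_stage_factorsThroughShift hX (m + 1) hX₀ (by exact_mod_cast hXm)
  obtain ⟨X', f, k, hT⟩ := distinguished_cocone_triangle₁ u
  have hT' := inv_rot_of_distTriang _ hT
  have hS' := inv_rot_of_distTriang _ S.distinguished
  let e : (h⟦((m + 1 : ℕ) : ℤ)⟧)⟦(-1 : ℤ)⟧ ≅ h⟦(m : ℤ)⟧ :=
    ((shiftFunctorAdd' 𝒟 ((m + 1 : ℕ) : ℤ) (-1) m (by push_cast; omega)).app h).symm
  have hfu : f ≫ u = 0 := comp_distTriang_mor_zero₁₂ _ hT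
  refine ⟨X', _, f, u, k, hT, ⟨⟨?_, ?_⟩, ?_⟩, ⟨h, hh, ⟨Iso.refl _⟩⟩⟩
  · exact C.ext_of_isTriangulatedClosed₁ _ hT hX (ctx.C_shift_of_mem hh _)
  · intro h' hh' j hj
    exact Orth.obj₂_right hT'
      ((ctx.orth_of_lt hh' hh (by omega : j < m)).of_iso (Iso.refl _) e.symm) (hX₀ h' hh' j hj)
  · intro h' hh' i hi g
    obtain ⟨y, hy⟩ : ∃ y : X ⟶ h'⟦i⟧, g = f ≫ y := Triangle.yoneda_exact₂ _ hT' g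
      ((ctx.orth_of_lt hh hh' (by omega : (m : ℤ) < i)).of_iso e.symm (Iso.refl _) _)
    rw [hy]
    obtain hi' | rfl : (m + 1 : ℤ) < i ∨ i = m + 1 := by omega
    · rw [hXm h' hh' i hi' y, comp_zero]
    · -- a morphism `X ⟶ h'⟦m + 1⟧` extends to the stage `S.Y`, hence factors through `u`
      have hG : Orth (S.G⟦(-1 : ℤ)⟧) (h'⟦(m + 1 : ℤ)⟧) :=
        (orth_shift_left_iff (by simp)).2
          ((S.orthAbove h' hh' (m + 1 + 1) (by push_cast; omega)).of_iso (Iso.refl _)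
            ((shiftFunctorAdd' 𝒟 (m + 1 : ℤ) 1 _ rfl).app h'))
      obtain ⟨y', hy'⟩ : ∃ y' : S.Y ⟶ h'⟦(m + 1 : ℤ)⟧, y = S.a ≫ y' :=
        Triangle.yoneda_exact₂ _ hS' y (hG _)
      rw [hy', ← huv, Category.assoc, reassoc_of% hfu, zero_comp]

/-- An object which is both `OrthBelow H a` and `OrthAbove H a` is a retract of a shift of an
object of `H`. -/
lemma exists_retract_shift {X : 𝒟} (hX : C X) {a : ℤ} (ha : OrthBelow H a X)
    (ha' : OrthAbove H a X) : (H.map (shiftFunctor 𝒟 a)).retractClosure X := by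
  obtain ⟨h, hh, ⟨r⟩⟩ := ctx.exists_retract_of_normalized (ctx.C_shift hX (-a))
    (ha.shift (by omega)) (ha'.shift (by omega))
  let e : X ≅ (X⟦-a⟧)⟦a⟧ := (shiftNegShift X a).symm
  exact ⟨h⟦a⟧, ⟨h, hh, ⟨Iso.refl _⟩⟩, ⟨(Retract.ofIso e).trans (r.map (shiftFunctor 𝒟 a))⟩⟩

/-- The top cell of an object of `C` can be split off. -/
lemma exists_peeling {X : 𝒟} (hX : C X) {a b : ℤ} (hab : a < b) (ha : OrthBelow H a X)
    (hb : OrthAbove H b X) :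
    (C ⊓ OrthBelow H a ⊓ OrthAbove H (b - 1)).extensionProduct (H.map (shiftFunctor 𝒟 b)) X := by
  obtain ⟨m, hm⟩ : ∃ m : ℕ, b - a = m + 1 := ⟨(b - a - 1).toNat, by omega⟩
  obtain ⟨X', R, f, g, k, hT, ⟨⟨hCX', hX'⟩, hX''⟩, ⟨h, hh, ⟨i⟩⟩⟩ :=
    ctx.exists_peeling_of_normalized (ctx.C_shift hX (-a)) m (ha.shift (by omega))
      (hb.shift (by omega))
  refine ObjectProperty.prop_of_iso _ (shiftNegShift X a)
    ⟨_, _, _, _, _, Triangle.shift_distinguished _ hT a, ⟨⟨ctx.C_shift hCX' a, ?_⟩, ?_⟩, ?_⟩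
  · exact OrthBelow.shift (X := X') (n := a) (a' := a) hX' (by omega)
  · exact OrthAbove.shift (X := X') (n := a) (b' := b - 1) hX'' (by omega)
  · exact ⟨h, hh, ⟨(shiftFunctorAdd' 𝒟 (m + 1 : ℤ) a b (by omega)).app h ≪≫
      (shiftFunctor 𝒟 a).mapIso i⟩⟩

/-- Induction on the number of cells: the objects of `C` with cells of dimensions from `a` to `b`
are obtained from those with cells of dimensions from `a` to `c` by attaching cells of dimensions
from `c + 1` to `b`. -/
lemma peeling_induction {a b c : ℤ} (hac : a ≤ c) {E : ObjectProperty 𝒟}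
    (base : C ⊓ OrthBelow H a ⊓ OrthAbove H c ≤ E)
    (step : ∀ i, c < i → i ≤ b → E.extensionProduct (H.map (shiftFunctor 𝒟 i)) ≤ E) :
    C ⊓ OrthBelow H a ⊓ OrthAbove H b ≤ E := by
  obtain ⟨n, hn⟩ : ∃ n : ℕ, b ≤ c + n := ⟨(b - c).toNat, by omega⟩
  induction n generalizing b with
  | zero => exact fun X hX => base X ⟨hX.1, hX.2.mono (by simpa using hn)⟩
  | succ n ih =>
    by_cases hcb : c < b
    · have ih' := ih (b := b - 1) (fun i hi hib => step i hi (by omega))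
        (by push_cast at hn; omega)
      rintro X ⟨⟨hX, ha⟩, hb⟩
      exact step b hcb le_rfl X (ObjectProperty.monotone_extensionProduct_left _ ih' X
        (ctx.exists_peeling hX (by omega) ha hb))
    · exact fun X hX => base X ⟨hX.1, hX.2.mono (by omega)⟩

lemma retractClosure_triangulatedSpan {X : 𝒟} (hX : C X) {a b : ℤ} (ha : OrthBelow H a X)
    (hb : OrthAbove H b X) : (triangulatedSpan H).retractClosure X := by
  have hmap (i : ℤ) : H.map (shiftFunctor 𝒟 i) ≤ triangulatedSpan H := by
    rintro X ⟨h, hh, ⟨e⟩⟩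
    exact (triangulatedSpan H).prop_of_iso e
      ((triangulatedSpan H).le_shift i h (le_triangulatedSpan H h hh))
  refine ctx.peeling_induction (E := (triangulatedSpan H).retractClosure) (le_refl a) ?_ ?_ X
    ⟨⟨hX, ha⟩, hb⟩
  · rintro X ⟨⟨hX, ha⟩, ha'⟩
    exact ObjectProperty.monotone_retractClosure (hmap a) X (ctx.exists_retract_shift hX ha ha')
  · intro i _ _
    refine (ObjectProperty.monotone_extensionProduct_right _
      ((hmap i).trans (ObjectProperty.le_retractClosure _))).trans ?_
    refine (ObjectProperty.extensionProduct_retractClosure_retractClosure_le _ _).trans ?_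
    exact ObjectProperty.monotone_retractClosure
      (ObjectProperty.extensionProduct_le_of_isTriangulatedClosed₂ le_rfl le_rfl)

lemma orth_of_orthAbove_of_orthBelow {X Z : 𝒟} (hX : C X) {a b : ℤ} (ha : OrthBelow H a X)
    (hb : OrthAbove H b X) (hZ : OrthBelow H (b + 1) Z) : Orth X Z := by
  have hmap (i : ℤ) (hi : i ≤ b) (Y : 𝒟) (hY : H.map (shiftFunctor 𝒟 i) Y) : Orth Y Z := by
    obtain ⟨h, hh, ⟨e⟩⟩ := hY
    exact (hZ h hh i (by omega)).of_iso e (Iso.refl _)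
  refine ctx.peeling_induction (E := fun X => Orth X Z) (a := min a b) (le_refl _) ?_ ?_ X
    ⟨⟨hX, ha.mono (by omega)⟩, hb⟩
  -- starting at `min a b` ensures that the retract in the base case is of dimension at most `b`
  · rintro X ⟨⟨hX, ha⟩, ha'⟩
    obtain ⟨Y, hY, ⟨r⟩⟩ := ctx.exists_retract_shift hX ha ha'
    exact (hmap _ (by omega) Y hY).of_retract r (Retract.refl _)
  · rintro i - hi X ⟨X', R, f, g, k, hT, hX', hR⟩
    exact Orth.obj₂_left hT hX' (hmap i hi R hR)

/-- The cells of dimension larger than `c` are separated from the others: peeling them off one by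
one and applying the associativity of extensions, they assemble to a quotient. -/
lemma exists_decomposition {X : 𝒟} (hX : C X) {a b : ℤ} (ha : OrthBelow H a X)
    (hb : OrthAbove H b X) (c : ℤ) :
    (C ⊓ OrthAbove H c).extensionProduct (C ⊓ OrthBelow H (c + 1)) X := by
  have := ctx.triangulated
  have := ctx.isoClosed
  have : (C ⊓ OrthBelow H (c + 1)).ContainsZero :=
    ⟨0, isZero_zero 𝒟, C.prop_zero, fun _ _ _ _ => Orth.of_isZero_right (isZero_zero 𝒟)⟩
  refine ctx.peeling_induction (a := min a c) (c := c) (by omega) ?_ ?_ X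
    ⟨⟨hX, ha.mono (by omega)⟩, hb⟩
  · rintro X ⟨⟨hX, -⟩, hX'⟩
    exact ObjectProperty.le_extensionProduct_left _ X ⟨hX, hX'⟩
  · intro i hi _
    rw [ObjectProperty.extensionProduct_assoc]
    refine ObjectProperty.monotone_extensionProduct_right _ ?_
    rintro Y ⟨Y', R, f, g, k, hT, hY', hR⟩
    have hR' := ctx.map_shift_le_inf_orthBelow (by omega : c + 1 ≤ i) R hR
    exact ⟨C.ext_of_isTriangulatedClosed₂ _ hT hY'.1 hR'.1,
      fun h hh j hj => Orth.obj₂_right hT (hY'.2 h hh j hj) (hR'.2 h hh j hj)⟩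

end IsGeneratingContext

end Triangulated

/-! ### The weight structure -/

section Subcategory

variable {𝒟 : Type u} [Category.{v} 𝒟] [Preadditive 𝒟] [HasZeroObject 𝒟] [HasShift 𝒟 ℤ]
  [∀ n : ℤ, (shiftFunctor 𝒟 n).Additive] [Pretriangulated 𝒟]

lemma isGeneratingContext_isoClosure {H D C : ObjectProperty 𝒟}
    (hsmall : ObjectProperty.EssentiallySmall.{v} H) (hadd : IsAdditive H) (hneg : IsNegative H)
    (hgen : WeaklyGenerates H) (hDext : ExtensionStable D) (hHD : H ≤ D)
    (hDshift : ∀ X : 𝒟, D X → D (X⟦(1 : ℤ)⟧)) (hDcoprod : HasSmallCoproductsIn D)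
    [C.IsTriangulated] (hCcomp : ∀ X : 𝒟, C X → IsCompactObject X) (hHC : H ≤ C) :
    IsGeneratingContext H D C.isoClosure where
  essentiallySmall := hsmall
  additive := hadd
  negative := hneg
  generates := hgen
  extensionStable := hDext
  le_D := hHD
  shift_D := hDshift
  coproducts := hDcoprod
  triangulated := inferInstance
  isoClosed := inferInstance
  compact := by
    rintro X ⟨Y, hY, ⟨e⟩⟩
    exact (hCcomp Y hY).of_iso e.symm
  le_C := hHC.trans C.le_isoClosure

variable {C : ObjectProperty 𝒟} [C.IsTriangulated]

lemma isAdditive_inverseImage_ι {P : ObjectProperty 𝒟} (hzero : ∀ Z : 𝒟, IsZero Z → P Z)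
    (hext : ExtensionStable P) : IsAdditive (P.inverseImage C.ι) where
  exists_zero := by
    obtain ⟨Z, hZ⟩ := HasZeroObject.zero (C := C.FullSubcategory)
    exact ⟨Z, hzero _ (C.ι.map_isZero hZ), hZ⟩
  exists_sum X Y hX hY :=
    ⟨BinaryBiproduct.bicone X Y, ⟨BinaryBiproduct.isBilimit X Y⟩,
      hext _ (C.ι.map_distinguished _ (binaryBiproductTriangle_distinguished X Y)) hX hY⟩

lemma OrthBelow.shift_ι {H : ObjectProperty 𝒟} {a : ℤ} {X : C.FullSubcategory}
    (hX : OrthBelow H a (C.ι.obj X)) {n a' : ℤ} (ha' : a + n = a') :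
    OrthBelow H a' (C.ι.obj (X⟦n⟧)) :=
  (OrthBelow H a').prop_of_iso ((C.ι.commShiftIso n).app X).symm (hX.shift ha')

lemma OrthAbove.shift_ι {H : ObjectProperty 𝒟} {b : ℤ} {X : C.FullSubcategory}
    (hX : OrthAbove H b (C.ι.obj X)) {n b' : ℤ} (hb' : b + n = b') :
    OrthAbove H b' (C.ι.obj (X⟦n⟧)) :=
  (OrthAbove H b').prop_of_iso ((C.ι.commShiftIso n).app X).symm (hX.shift hb')

lemma OrthBounds.orthBelow {H : ObjectProperty 𝒟} (hHC : H ≤ C) {X : C.FullSubcategory}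
    {j q : ℤ} (hX : OrthBounds (H.inverseImage C.ι) X j q) : OrthBelow H (-q) (C.ι.obj X) :=
  fun h hh i hi => (orth_shift_left_iff (by omega : i + -i = 0)).2
    ((orth_ι_iff.2 (hX.1 ⟨h, hHC h hh⟩ hh (-i) (by omega))).of_iso (Iso.refl _)
      ((C.ι.commShiftIso (-i)).app X))

lemma OrthBounds.orthAbove {H : ObjectProperty 𝒟} (hHC : H ≤ C) {X : C.FullSubcategory}
    {j q : ℤ} (hX : OrthBounds (H.inverseImage C.ι) X j q) : OrthAbove H (-j) (C.ι.obj X) :=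
  fun h hh i hi => (orth_shift_left_iff (by omega : -i + i = 0)).1
    ((orth_ι_iff.2 (hX.2 ⟨h, hHC h hh⟩ hh (-i) (by omega))).of_iso
      ((C.ι.commShiftIso (-i)).app X) (Iso.refl _))

variable [IsTriangulated 𝒟]

/-- A weight decomposition in the ambient category involves objects which are only isomorphic to
objects of `C`. It is replaced by an isomorphic triangle in `C` whose first object is literally of
the form `B⟦-1⟧`. -/
lemma exists_weightDecomposition {H D : ObjectProperty 𝒟}
    (ctx : IsGeneratingContext H D C.isoClosure) (X : C.FullSubcategory) {a b : ℤ}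
    (ha : OrthBelow H a (C.ι.obj X)) (hb : OrthAbove H b (C.ι.obj X)) :
    ∃ (A B : C.FullSubcategory) (_ : OrthBelow H 0 (C.ι.obj A)) (_ : OrthAbove H 0 (C.ι.obj B))
      (f : B⟦(-1 : ℤ)⟧ ⟶ X) (g : X ⟶ A) (h : A ⟶ (B⟦(-1 : ℤ)⟧)⟦(1 : ℤ)⟧),
      Triangle.mk f g h ∈ distTriang C.FullSubcategory := by
  obtain ⟨B', A', f, g, h, hT, ⟨⟨B₀, hB₀, ⟨e⟩⟩, hB'⟩, ⟨-, hA'⟩⟩ :=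
    ctx.exists_decomposition (C.le_isoClosure _ X.2) ha hb (-1)
  let B : C.FullSubcategory := (⟨B₀, hB₀⟩ : C.FullSubcategory)⟦(1 : ℤ)⟧
  let i : C.ι.obj (B⟦(-1 : ℤ)⟧) ≅ B' :=
    C.ι.mapIso (shiftShiftNeg (⟨B₀, hB₀⟩ : C.FullSubcategory) (1 : ℤ)) ≪≫ e.symm
  obtain ⟨f', hf'⟩ : ∃ f' : B⟦(-1 : ℤ)⟧ ⟶ X, C.ι.map f' = i.hom ≫ f := C.ι.map_surjective _
  obtain ⟨A, g', h', hT'⟩ := distinguished_cocone_triangle f'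
  let E := isoTriangleOfIso₁₂ _ _ (C.ι.map_distinguished _ hT') hT i (Iso.refl _)
    ((Category.comp_id _).trans hf')
  refine ⟨A, B, (OrthBelow H 0).prop_of_iso (Triangle.π₃.mapIso E).symm hA', ?_, f', g', h', hT'⟩
  exact OrthAbove.shift_ι (b := -1) ((OrthAbove H (-1)).prop_of_iso e hB') (by omega)

/-- The weight structure on `C` generated by `H`: an object `X` has weights `≤ 0` if `h ⊥ X⟦i⟧` for
all `h ∈ H` and `i > 0`, and weights `≥ 0` if `X ⊥ h⟦i⟧` for all `h ∈ H` and `i > 0`. -/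
def generatedWeightStructure {H D : ObjectProperty 𝒟}
    (ctx : IsGeneratingContext H D C.isoClosure)
    (hbdd : ∀ X : C.FullSubcategory,
      ∃ a b : ℤ, OrthBelow H a (C.ι.obj X) ∧ OrthAbove H b (C.ι.obj X)) :
    WeightStructure C.FullSubcategory where
  leZero := (OrthBelow H 0).inverseImage C.ι
  geZero := (OrthAbove H 0).inverseImage C.ι
  leZero_additive := isAdditive_inverseImage_ι
    (fun _ hZ _ _ _ _ => Orth.of_isZero_right hZ) (orthBelow_extensionStable H 0)
  geZero_additive := isAdditive_inverseImage_ι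
    (fun _ hZ _ _ _ _ => Orth.of_isZero_left hZ) (orthAbove_extensionStable H 0)
  leZero_karoubiClosed := isStableUnderRetracts_inverseImage_ι _
  geZero_karoubiClosed := isStableUnderRetracts_inverseImage_ι _
  leZero_shift _ hX := OrthBelow.mono (a := 1) (by omega) (OrthBelow.shift_ι hX (by omega))
  geZero_shift _ hX := OrthAbove.mono (b := -1) (by omega) (OrthAbove.shift_ι hX (by omega))
  orth X Y hX hY := by
    obtain ⟨a, -, ha, -⟩ := hbdd X
    exact orth_ι_iff.1 (ctx.orth_of_orthAbove_of_orthBelow (C.le_isoClosure _ X.2) ha hX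
      (OrthBelow.shift_ι hY (by omega)))
  exists_decomposition X := by
    obtain ⟨a, b, ha, hb⟩ := hbdd X
    exact exists_weightDecomposition ctx X ha hb

lemma heart_generatedWeightStructure {H D : ObjectProperty 𝒟}
    (ctx : IsGeneratingContext H D C.isoClosure) (hHC : H ≤ C)
    (hbdd : ∀ X : C.FullSubcategory,
      ∃ a b : ℤ, OrthBelow H a (C.ι.obj X) ∧ OrthAbove H b (C.ι.obj X)) :
    (generatedWeightStructure ctx hbdd).heart = (H.inverseImage C.ι).retractClosure := by
  refine le_antisymm ?_ ?_
  · rintro X ⟨hX, hX'⟩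
    obtain ⟨h, hh, ⟨r⟩⟩ := ctx.exists_retract_of_normalized (C.le_isoClosure _ X.2) hX' hX
    let h' : C.FullSubcategory := ⟨h, hHC h hh⟩
    obtain ⟨i, hi⟩ : ∃ i : X ⟶ h', C.ι.map i = r.i := C.ι.map_surjective _
    obtain ⟨s, hs⟩ : ∃ s : h' ⟶ X, C.ι.map s = r.r := C.ι.map_surjective _
    exact ⟨h', hh, ⟨⟨i, s, C.ι.map_injective (by
      rw [Functor.map_comp, hi, hs, CategoryTheory.Functor.map_id]; exact r.retract)⟩⟩⟩
  · rintro X ⟨Y, hY, ⟨r⟩⟩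
    exact ⟨(OrthAbove H 0).prop_of_retract (r.map C.ι) (OrthAbove.of_mem ctx.negative hY),
      (OrthBelow H 0).prop_of_retract (r.map C.ι) (OrthBelow.of_mem ctx.negative hY)⟩

end Subcategory

end WeightLemma

theorem proposition1p4p1
    {𝒟 : Type u} [Category.{v} 𝒟] [Preadditive 𝒟] [HasZeroObject 𝒟] [HasShift 𝒟 ℤ]
    [∀ n : ℤ, (shiftFunctor 𝒟 n).Additive] [Pretriangulated 𝒟] [IsTriangulated 𝒟]
    -- the additive, negative set `H` of compact objects weakly generating `𝒟`
    (H : ObjectProperty 𝒟) (hsmall : ObjectProperty.EssentiallySmall.{v} H)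
    (hadd : WeightLemma.IsAdditive H) (hneg : WeightLemma.IsNegative H)
    (hcomp : ∀ X : 𝒟, H X → WeightLemma.IsCompactObject X)
    (hgen : WeightLemma.WeaklyGenerates H)
    -- the extension-stable class `D` with small coproducts
    (D : ObjectProperty 𝒟) (hDext : WeightLemma.ExtensionStable D)
    (hHD : H ≤ D) (hDshift : ∀ X : 𝒟, D X → D (X⟦(1 : ℤ)⟧))
    (hDcoprod : WeightLemma.HasSmallCoproductsIn D)
    -- the full triangulated subcategory `C` of `𝒟`
    (C : ObjectProperty 𝒟) [C.IsTriangulated] (hC : IsIdempotentComplete C.FullSubcategory)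
    (hCcomp : ∀ X : 𝒟, C X → WeightLemma.IsCompactObject X) (hHC : H ≤ C)
    (hCbdd : WeightLemma.BoundedWithRespectTo (H.inverseImage C.ι)) :
    C ≤ (WeightLemma.triangulatedSpan H).retractClosure ∧
    ∃ w : WeightLemma.WeightStructure C.FullSubcategory,
      w.IsBounded ∧
      w.heart = (H.inverseImage C.ι).retractClosure ∧
      ∀ (X : C.FullSubcategory) (j q : ℤ),
        WeightLemma.OrthBounds (H.inverseImage C.ι) X j q → w.interval j q X := by
  have ctx : WeightLemma.IsGeneratingContext H D C.isoClosure :=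
    WeightLemma.isGeneratingContext_isoClosure hsmall hadd hneg hgen hDext hHD hDshift hDcoprod
      hCcomp hHC
  have hbdd (X : C.FullSubcategory) : ∃ a b : ℤ, WeightLemma.OrthBelow H a (C.ι.obj X) ∧
      WeightLemma.OrthAbove H b (C.ι.obj X) := by
    obtain ⟨j, q, hX⟩ := hCbdd X
    exact ⟨-q, -j, hX.orthBelow hHC, hX.orthAbove hHC⟩
  have hinterval (X : C.FullSubcategory) (j q : ℤ)
      (hX : WeightLemma.OrthBounds (H.inverseImage C.ι) X j q) :
      (WeightLemma.generatedWeightStructure ctx hbdd).interval j q X :=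
    ⟨WeightLemma.OrthAbove.shift_ι (hX.orthAbove hHC) (by omega),
      WeightLemma.OrthBelow.shift_ι (hX.orthBelow hHC) (by omega)⟩
  refine ⟨fun X hX => ?_, WeightLemma.generatedWeightStructure ctx hbdd, fun X => ?_,
    WeightLemma.heart_generatedWeightStructure ctx hHC hbdd, hinterval⟩
  · obtain ⟨a, b, ha, hb⟩ := hbdd ⟨X, hX⟩
    exact ctx.retractClosure_triangulatedSpan (C.le_isoClosure X hX) ha hb
  · obtain ⟨j, q, hX⟩ := hCbdd X
    exact ⟨⟨q, (hinterval X j q hX).2⟩, ⟨j, (hinterval X j q hX).1⟩⟩
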